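/- Let $n\ge 1$, $A_n=\mathbb C[t_1,\dots,t_n]$, $\partial_i=\partial/\partial t_i$, $W_n=\mathrm{Der}_{\mathbb C}(A_n)$, $\Delta_n=\mathrm{span}_{\mathbb C}\{\partial_1,\dots,\partial_n\}\subset W_n$. An $(A_n,W_n)$-module is a complex vector space $M$ with a unital associative $A_n$-module structure and a $W_n$-module structure such that $D(fv)=D(f)v+f(Dv)$ for all $D\in W_n$, $f\in A_n$, $v\in M$ (equivalently, a module over the smash product $A_n\# U(W_n)$). For $\mathbf a=(a_1,\dots,a_n)\in\mathbb C^n$ let $\phi_{\mathbf a}:\Delta_n\to\mathbb C$ be the linear map with $\phi_{\mathbf a}(\partial_i)=a_i$. The module $M$ is a Whittaker module if $\Delta_n$ acts on it locally finitely, and is of type $\phi_{\mathbf a}$ if moreover for every $v\in M$ there is $k\in\mathbb N$ with $(x-\phi_{\mathbf a}(x))^kv=0$ for all $x\in\Delta_n$. Put $\mathrm{Wh}_{\mathbf a}(M)=\{v\in M: xv=\phi_{\mathbf a}(x)v\ \ \forall x\in\Delta_n\}$. For a $\mathfrak{gl}_n(\mathbb C)$-module $V$, let $T(A_n^{\mathbf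 a},V)$ be the $(A_n,W_n)$-module $A_n\otimes_{\mathbb C} V$ with the action $$t^{\mathbf m}(p\otimes v)=(t^{\mathbf m}p)\otimes v,\qquad t^{\mathbf m}\partial_k(p\otimes v)=t^{\mathbf m}(\partial_k p+a_kp)\otimes v+\sum_{i=1}^n m_i\,t^{\mathbf m-\mathbf e_i}p\otimes e_{ik}v,$$ for $\mathbf m\in\mathbb Z_{\ge0}^n$, $1\le k\le n$, $p\in A_n$, $v\in V$, where $e_{ik}$ are the matrix units and $\mathbf e_i$ the standard basis vectors. Let $\mathbf a\in\mathbb C^n$ and let $M$ be a simple Whittaker $(A_n,W_n)$-module of type $\phi_{\mathbf a}$ with $\dim \mathrm{Wh}_{\mathbf a}(M)<\infty$. Then there is a finite-dimensional simple $\mathfrak{gl}_n(\mathbb C)$-module $V$ such that $M\cong T(A_n^{\mathbf a},V)$ as $(A_n,W_n)$-modules. -/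

import Mathlib

noncomputable section

open scoped TensorProduct

namespace WittWhittaker

/-- The polynomial algebra `A_n = ℂ[t_1, …, t_n]`. -/
abbrev A (n : ℕ) : Type := MvPolynomial (Fin n) ℂ

/-- The Witt algebra `W_n = Der(A_n)`, with the commutator bracket. -/
abbrev W (n : ℕ) : Type := Derivation ℂ (A n) (A n)

/-- The general linear Lie algebra `gl_n` over `ℂ`, with the commutator bracket. -/
abbrev Gl (n : ℕ) : Type := Matrix (Fin n) (Fin n) ℂ

instance (n : ℕ) : LieRing (Gl n) := LieRing.ofAssociativeRing

instance (n : ℕ) : LieAlgebra ℂ (Gl n) := LieAlgebra.ofAssociativeAlgebra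

/-! ### `(A_n, W_n)`-modules -/

/-- `M` is an `(A_n, W_n)`-module, that is, a module over the smash product `A_n # U(W_n)`: it
carries a (unital, associative) `A_n`-action and a `W_n`-action over `ℂ`, which together form an
action of the semidirect product `W_n ⋉ A_n`: the commutator of `D ∈ W_n` and `f ∈ A_n` acts on `M`
as `D(f) ∈ A_n`. -/
class IsAWModule (n : ℕ) (M : Type*) [AddCommGroup M] [Module ℂ M] [Module (A n) M]
    [LieRingModule (W n) M] : Prop extends IsScalarTower ℂ (A n) M, LieModule ℂ (W n) M where
  lie_smul_eq : ∀ (D : W n) (f : A n) (v : M), ⁅D, f • v⁆ = D f • v + f • ⁅D, v⁆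

/-- A simple `(A_n, W_n)`-module: it is nonzero, and `0` and `M` are its only subspaces that are
stable under both `A_n` and `W_n`. -/
def IsSimpleAWModule (n : ℕ) (M : Type*) [AddCommGroup M] [Module (A n) M]
    [LieRingModule (W n) M] : Prop :=
  Nontrivial M ∧
    ∀ N : Submodule (A n) M, (∀ (D : W n), ∀ v ∈ N, ⁅D, v⁆ ∈ N) → N = ⊥ ∨ N = ⊤

/-- Isomorphisms of `(A_n, W_n)`-modules: bijections that are `A_n`-linear (hence `ℂ`-linear)
and commute with the action of `W_n`. -/
structure AWEquiv (n : ℕ) (M N : Type*) [AddCommGroup M] [Module (A n) M]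
    [LieRingModule (W n) M] [AddCommGroup N] [Module (A n) N] [LieRingModule (W n) N]
    extends M ≃ₗ[A n] N where
  map_lie' : ∀ (D : W n) (v : M), toFun ⁅D, v⁆ = ⁅D, toFun v⁆

/-! ### Whittaker modules -/

/-- `∂_i = ∂/∂t_i`, as an element of `W_n`. -/
abbrev del {n : ℕ} (i : Fin n) : W n := MvPolynomial.pderiv i

/-- `Δ_n = span {∂_1, …, ∂_n}`, a subspace (in fact an abelian subalgebra) of `W_n`. -/
def Delta (n : ℕ) : Submodule ℂ (W n) := Submodule.span ℂ (Set.range del)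

/-- The linear functional `φ_a` on `Δ_n` with `φ_a(∂_i) = a_i`, see `phi_del`: the coefficient of
`∂_i` in `x ∈ Δ_n` is the constant `x(t_i)`. -/
def phi {n : ℕ} (a : Fin n → ℂ) : Delta n →ₗ[ℂ] ℂ where
  toFun x := ∑ i, a i * MvPolynomial.constantCoeff ((x : W n) (MvPolynomial.X i))
  map_add' x y := by simp [mul_add, Finset.sum_add_distrib]
  map_smul' c x := by
    simp only [Submodule.coe_smul, Derivation.smul_apply, MvPolynomial.smul_eq_C_mul, map_mul,
      MvPolynomial.constantCoeff_C, RingHom.id_apply, smul_eq_mul, Finset.mul_sum]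
    exact Finset.sum_congr rfl fun i _ => by ring

theorem phi_del {n : ℕ} (a : Fin n → ℂ) (i : Fin n) :
    phi a ⟨del i, Submodule.subset_span ⟨i, rfl⟩⟩ = a i := by
  simp [phi, MvPolynomial.pderiv_X, Pi.single_apply, apply_ite]

section Whittaker

variable {n : ℕ} (a : Fin n → ℂ) (M : Type*) [AddCommGroup M] [Module ℂ M]
  [LieRingModule (W n) M]

/-- The operator `x - φ_a(x)` on a `W_n`-module, for `x ∈ Δ_n`. -/
def shifted {M : Type*} [AddCommGroup M] [Module ℂ M] [LieRingModule (W n) M]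
    (x : Delta n) (v : M) : M := ⁅(x : W n), v⁆ - phi a x • v

/-- A Whittaker module: `Δ_n` acts locally finitely, i.e. every vector lies in a finite-dimensional
`Δ_n`-stable subspace. -/
def IsWhittaker (n : ℕ) (M : Type*) [AddCommGroup M] [Module ℂ M] [LieRingModule (W n) M] : Prop :=
  ∀ v : M, ∃ N : Submodule ℂ M, FiniteDimensional ℂ N ∧ v ∈ N ∧
    ∀ x ∈ Delta n, ∀ w ∈ N, ⁅x, w⁆ ∈ N

/-- A Whittaker module of type `φ_a`: for every `v` there is `k` with `(x - φ_a(x))^k v = 0` for all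
`x ∈ Δ_n`. -/
def IsWhittakerOfType : Prop :=
  IsWhittaker n M ∧ ∀ v : M, ∃ k : ℕ, ∀ x : Delta n, (shifted a x)^[k] v = 0

/-- The space of Whittaker vectors `Wh_a(M) = {v | x v = φ_a(x) v for all x ∈ Δ_n}`. -/
def Wh [LieModule ℂ (W n) M] : Submodule ℂ M where
  carrier := {v | ∀ x : Delta n, ⁅(x : W n), v⁆ = phi a x • v}
  zero_mem' x := by simp
  add_mem' hv hw x := by rw [lie_add, hv x, hw x, smul_add]
  smul_mem' c v hv x := by rw [lie_smul, hv x, smul_comm]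

end Whittaker

/-! ### The modules `T(A_n^a, V)` -/

/-- The action of `D = ∑ k, f_k ∂_k` on `A_n^a`, the natural module over the Weyl algebra twisted by
`t_i ↦ t_i`, `∂_i ↦ ∂_i + a_i`:  `D · p = D(p) + (∑ k, a_k f_k) p`, where `f_k = D(t_k)`. -/
def twist {n : ℕ} (a : Fin n → ℂ) (D : W n) : A n →ₗ[ℂ] A n :=
  (D : A n →ₗ[ℂ] A n) + LinearMap.mulLeft ℂ (∑ k, a k • D (MvPolynomial.X k))

section Action

variable {n : ℕ} (a : Fin n → ℂ) (V : Type*) [AddCommGroup V] [Module ℂ V]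
  [LieRingModule (Gl n) V] [LieModule ℂ (Gl n) V]

/-- The action of `D = ∑ k, f_k ∂_k ∈ W_n` on `T(A_n^a, V) = A_n^a ⊗ V`:
`D (p ⊗ v) = (D · p) ⊗ v + ∑ i, ∑ k, ∂_i(f_k) p ⊗ e_{ik} v`, with `D · p` taken in `A_n^a`.
In particular `t^m ∂_k (p ⊗ v) = (t^m ∂_k · p) ⊗ v + ∑ i, m_i t^{m - e_i} p ⊗ e_{ik} v`. -/
def tAct (D : W n) : A n ⊗[ℂ] V →ₗ[ℂ] A n ⊗[ℂ] V :=
  TensorProduct.map (twist a D) LinearMap.id +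
    ∑ i, ∑ k, TensorProduct.map (LinearMap.mulLeft ℂ (del i (D (MvPolynomial.X k))))
      (LieModule.toEnd ℂ (Gl n) V (Matrix.single i k 1))

variable {V}

theorem tAct_tmul (D : W n) (p : A n) (v : V) :
    tAct a V D (p ⊗ₜ[ℂ] v) = twist a D p ⊗ₜ[ℂ] v +
      ∑ i, ∑ k, (del i (D (MvPolynomial.X k)) * p) ⊗ₜ[ℂ] ⁅(Matrix.single i k 1 : Gl n), v⁆ := by
  simp only [tAct, LinearMap.add_apply, LinearMap.sum_apply, TensorProduct.map_tmul]
  rfl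

theorem twist_apply (D : W n) (p : A n) :
    twist a D p = D p + (∑ k, a k • D (MvPolynomial.X k)) * p := rfl

theorem tAct_add (D E : W n) : tAct a V (D + E) = tAct a V D + tAct a V E := by
  refine TensorProduct.ext' fun p v => ?_
  rw [LinearMap.add_apply, tAct_tmul, tAct_tmul, tAct_tmul]
  simp only [twist_apply, Derivation.add_apply, map_add, smul_add, Finset.sum_add_distrib, add_mul,
    TensorProduct.add_tmul]
  abel

theorem tAct_smul (c : ℂ) (D : W n) : tAct a V (c • D) = c • tAct a V D := by
  refine TensorProduct.ext' fun p v => ?_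
  rw [LinearMap.smul_apply, tAct_tmul, tAct_tmul]
  simp only [twist_apply, Derivation.smul_apply, Derivation.map_smul, smul_add, Finset.smul_sum,
    TensorProduct.smul_tmul', smul_mul_assoc, smul_comm (_ : ℂ) c, TensorProduct.add_tmul,
    Finset.sum_mul]

theorem tAct_smul_right (D : W n) (f : A n) (x : A n ⊗[ℂ] V) :
    tAct a V D (f • x) = D f • x + f • tAct a V D x := by
  induction x using TensorProduct.induction_on with
  | zero => simp
  | add x y hx hy => rw [smul_add, map_add, hx, hy, map_add, smul_add, smul_add]; abel
  | tmul p v =>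
    rw [TensorProduct.smul_tmul', TensorProduct.smul_tmul', tAct_tmul,
      tAct_tmul, smul_add, TensorProduct.smul_tmul', ← add_assoc, ← TensorProduct.add_tmul,
      Finset.smul_sum]
    congr 1
    · congr 1
      simp only [twist_apply, smul_eq_mul, Derivation.leibniz]
      ring
    · refine Finset.sum_congr rfl fun i _ => ?_
      rw [Finset.smul_sum]
      refine Finset.sum_congr rfl fun k _ => ?_
      rw [TensorProduct.smul_tmul', smul_eq_mul, smul_eq_mul, mul_left_comm]

theorem apply_eq_sum (D : W n) (f : A n) :
    D f = ∑ l, D (MvPolynomial.X l) * del l f := by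
  have hs (f : A n) : (∑ l, D (MvPolynomial.X l) • (del l : W n)) f =
      ∑ l, D (MvPolynomial.X l) * del l f := by
    have := congrFun (map_sum (Derivation.coeFnAddMonoidHom (R := ℂ) (A := A n) (M := A n))
      (fun l => D (MvPolynomial.X l) • (del l : W n)) Finset.univ) f
    rw [Finset.sum_apply] at this
    exact this
  have h : D = ∑ l, D (MvPolynomial.X l) • (del l : W n) := by
    refine MvPolynomial.derivation_ext fun i => ?_
    rw [hs, Finset.sum_eq_single i]
    · simp
    · intro b _ hb
      simp [MvPolynomial.pderiv_X_of_ne hb.symm]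
    · simp
  rw [← hs, ← h]

theorem del_apply (D : W n) (i : Fin n) (f : A n) :
    del i (D f) = D (del i f) + ∑ l, del i (D (MvPolynomial.X l)) * del l f := by
  have h := apply_eq_sum ⁅(del i : W n), D⁆ f
  have h2 (l : Fin n) : D (del i (MvPolynomial.X l)) = 0 := by
    by_cases hl : l = i
    · subst hl; simp
    · simp [MvPolynomial.pderiv_X_of_ne hl]
  simp only [Derivation.commutator_apply, h2, sub_zero] at h
  rw [← h]; ring

theorem twist_lie (D E : W n) (p : A n) :
    twist a ⁅D, E⁆ p = twist a D (twist a E p) - twist a E (twist a D p) := by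
  have h : (∑ k, a k • ⁅D, E⁆ (MvPolynomial.X k)) =
      D (∑ k, a k • E (MvPolynomial.X k)) - E (∑ k, a k • D (MvPolynomial.X k)) := by
    simp only [map_sum, Derivation.map_smul, Derivation.commutator_apply, smul_sub,
      Finset.sum_sub_distrib]
  rw [twist_apply, h]
  simp only [twist_apply, Derivation.commutator_apply, map_add, Derivation.leibniz, smul_eq_mul]
  ring

theorem twist_mul (D : W n) (f p : A n) : twist a D (f * p) = D f * p + f * twist a D p := by
  simp only [twist_apply, Derivation.leibniz, smul_eq_mul]
  ring

theorem del_lie (D E : W n) (i k : Fin n) :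
    del i (⁅D, E⁆ (MvPolynomial.X k)) =
      (D (del i (E (MvPolynomial.X k))) - E (del i (D (MvPolynomial.X k)))) +
      (∑ l, del i (D (MvPolynomial.X l)) * del l (E (MvPolynomial.X k)) -
        ∑ l, del i (E (MvPolynomial.X l)) * del l (D (MvPolynomial.X k))) := by
  rw [Derivation.commutator_apply, map_sub, del_apply D i (E _), del_apply E i (D _)]
  ring

theorem sum_four_comm {N : Type*} [AddCommMonoid N] (F : Fin n → Fin n → Fin n → Fin n → N) :
    ∑ j, ∑ l, ∑ i, ∑ k, F i k j l = ∑ i, ∑ k, ∑ j, ∑ l, F i k j l := by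
  have h := Finset.sum_comm (s := Finset.univ) (t := Finset.univ)
    (f := fun (x y : Fin n × Fin n) => F y.1 y.2 x.1 x.2)
  simpa only [Fintype.sum_prod_type] using h

theorem lie_single_lie_single (i k j l : Fin n) (v : V) :
    ⁅(Matrix.single i k 1 : Gl n), ⁅(Matrix.single j l 1 : Gl n), v⁆⁆ =
      ⁅(Matrix.single j l 1 : Gl n), ⁅(Matrix.single i k 1 : Gl n), v⁆⁆ +
      ((if k = j then ⁅(Matrix.single i l 1 : Gl n), v⁆ else 0) -
        if l = i then ⁅(Matrix.single j k 1 : Gl n), v⁆ else 0) := by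
  have h (i k j l : Fin n) : (Matrix.single i k 1 * Matrix.single j l 1 : Gl n) =
      if k = j then Matrix.single i l 1 else 0 := by
    split_ifs with hkj
    · subst hkj; simp
    · rw [Matrix.single_mul_single_of_ne _ _ _ _ hkj]
  rw [leibniz_lie, LieRing.of_associative_ring_bracket, h, h, sub_lie, add_comm]
  congr 2 <;> split_ifs <;> simp

theorem tAct_tAct_tmul (D E : W n) (p : A n) (v : V) :
    tAct a V D (tAct a V E (p ⊗ₜ[ℂ] v)) =
      twist a D (twist a E p) ⊗ₜ[ℂ] v +
      (∑ i, ∑ k, (del i (D (MvPolynomial.X k)) * twist a E p) ⊗ₜ[ℂ]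
          ⁅(Matrix.single i k 1 : Gl n), v⁆ +
        ∑ i, ∑ k, (del i (E (MvPolynomial.X k)) * twist a D p) ⊗ₜ[ℂ]
          ⁅(Matrix.single i k 1 : Gl n), v⁆) +
      ∑ i, ∑ k, (D (del i (E (MvPolynomial.X k))) * p) ⊗ₜ[ℂ] ⁅(Matrix.single i k 1 : Gl n), v⁆ +
      ∑ i, ∑ k, ∑ j, ∑ l, (del i (D (MvPolynomial.X k)) * del j (E (MvPolynomial.X l)) * p) ⊗ₜ[ℂ]
        ⁅(Matrix.single i k 1 : Gl n), ⁅(Matrix.single j l 1 : Gl n), v⁆⁆ := by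
  rw [tAct_tmul a E, map_add, tAct_tmul]
  simp only [map_sum, tAct_tmul, twist_mul, TensorProduct.add_tmul, Finset.sum_add_distrib]
  rw [sum_four_comm]
  simp only [mul_assoc]
  abel

theorem sum_comm_aux (P Q : Fin n → Fin n → A n) (p : A n) (v : V) :
    ∑ i, ∑ k, ∑ j, ∑ l, (P i k * Q j l * p) ⊗ₜ[ℂ]
        ⁅(Matrix.single i k 1 : Gl n), ⁅(Matrix.single j l 1 : Gl n), v⁆⁆ =
      ∑ i, ∑ k, ∑ j, ∑ l, (Q i k * P j l * p) ⊗ₜ[ℂ]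
        ⁅(Matrix.single i k 1 : Gl n), ⁅(Matrix.single j l 1 : Gl n), v⁆⁆ +
      (∑ i, ∑ k, ((∑ l, P i l * Q l k) * p) ⊗ₜ[ℂ] ⁅(Matrix.single i k 1 : Gl n), v⁆ -
        ∑ i, ∑ k, ((∑ l, Q i l * P l k) * p) ⊗ₜ[ℂ] ⁅(Matrix.single i k 1 : Gl n), v⁆) := by
  rw [← sum_four_comm (fun i k j l => (Q i k * P j l * p) ⊗ₜ[ℂ]
    ⁅(Matrix.single i k 1 : Gl n), ⁅(Matrix.single j l 1 : Gl n), v⁆⁆)]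
  have h1 : ∑ i, ∑ k, ((∑ l, P i l * Q l k) * p) ⊗ₜ[ℂ] ⁅(Matrix.single i k 1 : Gl n), v⁆ =
      ∑ i, ∑ k, ∑ j, ∑ l, (P i k * Q j l * p) ⊗ₜ[ℂ]
        (if k = j then ⁅(Matrix.single i l 1 : Gl n), v⁆ else 0) := by
    refine Finset.sum_congr rfl fun i _ => ?_
    simp only [Finset.sum_mul, TensorProduct.sum_tmul]
    rw [Finset.sum_comm]
    refine Finset.sum_congr rfl fun k _ => ?_
    rw [Finset.sum_comm]
    refine Finset.sum_congr rfl fun l _ => ?_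
    rw [Finset.sum_eq_single k] <;> simp +contextual [eq_comm]
  have h2 : ∑ j, ∑ k, ((∑ l, Q j l * P l k) * p) ⊗ₜ[ℂ] ⁅(Matrix.single j k 1 : Gl n), v⁆ =
      ∑ i, ∑ k, ∑ j, ∑ l, (P i k * Q j l * p) ⊗ₜ[ℂ]
        (if l = i then ⁅(Matrix.single j k 1 : Gl n), v⁆ else 0) := by
    rw [← sum_four_comm]
    refine Finset.sum_congr rfl fun j _ => ?_
    simp only [Finset.sum_mul, TensorProduct.sum_tmul]
    rw [Finset.sum_comm]
    refine Finset.sum_congr rfl fun l _ => ?_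
    rw [Finset.sum_comm]
    refine Finset.sum_congr rfl fun k _ => ?_
    rw [Finset.sum_eq_single l] <;> simp +contextual [eq_comm, mul_comm]
  rw [h1, h2]
  simp only [← Finset.sum_sub_distrib, ← Finset.sum_add_distrib, ← TensorProduct.tmul_sub]
  refine Finset.sum_congr rfl fun i _ => Finset.sum_congr rfl fun k _ =>
    Finset.sum_congr rfl fun j _ => Finset.sum_congr rfl fun l _ => ?_
  rw [lie_single_lie_single, TensorProduct.tmul_add, mul_comm (Q j l)]

theorem tAct_lie (D E : W n) (x : A n ⊗[ℂ] V) :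
    tAct a V D (tAct a V E x) = tAct a V ⁅D, E⁆ x + tAct a V E (tAct a V D x) := by
  induction x using TensorProduct.induction_on with
  | zero => simp
  | add x y hx hy => simp only [map_add, hx, hy]; abel
  | tmul p v =>
    rw [tAct_tAct_tmul, tAct_tAct_tmul, tAct_tmul, twist_lie, sum_comm_aux]
    simp only [del_lie, add_mul, sub_mul, TensorProduct.add_tmul, TensorProduct.sub_tmul,
      Finset.sum_add_distrib, Finset.sum_sub_distrib]
    abel

end Action

/-- The underlying space `A_n^a ⊗ V` of `T(A_n^a, V)`. -/
def T {n : ℕ} (_a : Fin n → ℂ) (V : Type*) [AddCommGroup V] [Module ℂ V] : Type _ := A n ⊗[ℂ] V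

section T

variable {n : ℕ} (a : Fin n → ℂ) (V : Type*) [AddCommGroup V] [Module ℂ V]

instance : AddCommGroup (T a V) := inferInstanceAs (AddCommGroup (A n ⊗[ℂ] V))

instance : Module ℂ (T a V) := inferInstanceAs (Module ℂ (A n ⊗[ℂ] V))

/-- `f · (p ⊗ v) = (f p) ⊗ v`. -/
instance : Module (A n) (T a V) := inferInstanceAs (Module (A n) (A n ⊗[ℂ] V))

instance : IsScalarTower ℂ (A n) (T a V) :=
  inferInstanceAs (IsScalarTower ℂ (A n) (A n ⊗[ℂ] V))

variable [LieRingModule (Gl n) V] [LieModule ℂ (Gl n) V]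

instance : LieRingModule (W n) (T a V) where
  bracket D x := tAct a V D x
  add_lie D E x := LinearMap.congr_fun (tAct_add a D E) x
  lie_add D x y := map_add (tAct a V D) x y
  leibniz_lie D E x := tAct_lie a D E x

instance : LieModule ℂ (W n) (T a V) where
  smul_lie c D x := LinearMap.congr_fun (tAct_smul a c D) x
  lie_smul c D x := map_smul (tAct a V D) c x

instance : IsAWModule n (T a V) where
  lie_smul_eq D f x := tAct_smul_right a D f x

end T

end WittWhittaker

end

open WittWhittaker

universe u

set_option linter.unusedSectionVars false

noncomputable section

open scoped TensorProduct

/-! The operators d_i = ∂_i - a_i commute and satisfy the Leibniz rule over A_n, so M is a module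
over the Weyl algebra, and being of type φ_a makes the d_i locally nilpotent. In characteristic zero
such a module is free over its constants: M = A_n ⊗ M^d (`ofInvariants_injective`,
`ofInvariants_surjective`). Moreover M = M^d ⊕ ∑ t_i M, so M^d is the fibre of M at the origin. A
vector that is constant modulo a Weyl submodule is therefore tested at the origin
(`mem_of_mem_sup_augmentation`).

Vector fields vanishing at the origin preserve ∑ t_i M and so act on the fibre. A stable subspace of
the fibre generates an (A_n, W_n)-submodule that meets the fibre in no more than that subspace, so
the fibre is simple for them (`eq_bot_or_eq_top_of_originAction_mem`). It is finite-dimensional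
because it lies in Wh_a(M). Take an eigenvector of the Euler field whose eigenvalue has maximal real
part: fields vanishing to order two raise the eigenvalue and must kill it. These fields form an
ideal, so by simplicity they kill the whole fibre (`VanishesTwice.originAction_eq_zero`).

Thus only linear parts act, and the fibre is a simple gl_n-module V. Taylor expansion then
determines the action of every field on constants (`lie_coe_eq`), and it is the action of T(A_n^a,
V). -/

namespace WittWhittaker

/-! ### Weyl algebra modules with locally nilpotent derivations -/

section WeylAction

variable {n : ℕ} {M : Type*} [AddCommGroup M] [Module ℂ M] [Module (A n) M]
  [IsScalarTower ℂ (A n) M]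

/-- Operators `d_i` which, together with the `A_n`-action, make `M` a module over the Weyl
algebra. -/
structure IsWeylAction (d : Fin n → Module.End ℂ M) : Prop where
  comm : ∀ i j v, d i (d j v) = d j (d i v)
  leibniz : ∀ i (f : A n) v, d i (f • v) = del i f • v + f • d i v

/-- The vectors killed by all `d_i`. -/
def invariants (d : Fin n → Module.End ℂ M) : Submodule ℂ M := ⨅ i, LinearMap.ker (d i)

/-- The vectors killed by all words of length `N` in the `d_i`. -/
def filt (d : Fin n → Module.End ℂ M) : ℕ → Submodule ℂ M
  | 0 => ⊥
  | N + 1 => ⨅ i, (filt d N).comap (d i)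

/-- The Euler operator `∑ t_i d_i`. -/
def euler (d : Fin n → Module.End ℂ M) (v : M) : M :=
  ∑ i, (MvPolynomial.X i : A n) • d i v

variable (n M) in
/-- The submodule `∑ t_i M`. -/
def augmentation : Submodule (A n) M :=
  LinearMap.range (∑ i, (MvPolynomial.X i : A n) • LinearMap.proj (R := A n) (φ := fun _ => M) i)

theorem mem_augmentation {v : M} :
    v ∈ augmentation n M ↔ ∃ w : Fin n → M, ∑ i, (MvPolynomial.X i : A n) • w i = v := by
  simp [augmentation, LinearMap.sum_apply]

theorem X_smul_mem_augmentation (i : Fin n) (v : M) :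
    (MvPolynomial.X i : A n) • v ∈ augmentation n M := by
  refine mem_augmentation.2 ⟨Pi.single i v, ?_⟩
  rw [Finset.sum_eq_single i] <;> simp +contextual

theorem smul_sub_constantCoeff_smul_mem (f : A n) (v : M) :
    f • v - MvPolynomial.constantCoeff f • v ∈ augmentation n M := by
  induction f using MvPolynomial.induction_on with
  | C c =>
    rw [MvPolynomial.constantCoeff_C, ← MvPolynomial.algebraMap_eq, algebraMap_smul, sub_self]
    exact zero_mem _
  | add p q hp hq =>
    convert add_mem hp hq using 1
    rw [map_add, add_smul, add_smul]; abel
  | mul_X p i _ =>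
    rw [map_mul, MvPolynomial.constantCoeff_X, mul_zero, zero_smul, sub_zero, mul_comm, mul_smul]
    exact X_smul_mem_augmentation i _

theorem smul_mem_augmentation {f : A n} (hf : MvPolynomial.constantCoeff f = 0) (v : M) :
    f • v ∈ augmentation n M := by
  simpa [hf] using smul_sub_constantCoeff_smul_mem f v

variable {d : Fin n → Module.End ℂ M}

theorem mem_invariants {v : M} : v ∈ invariants d ↔ ∀ i, d i v = 0 := by
  simp [invariants, Submodule.mem_iInf]

theorem mem_filt_zero {v : M} : v ∈ filt d 0 ↔ v = 0 := Iff.rfl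

theorem mem_filt_succ {N : ℕ} {v : M} : v ∈ filt d (N + 1) ↔ ∀ i, d i v ∈ filt d N := by
  simp [filt, Submodule.mem_iInf]

theorem filt_le_succ (N : ℕ) : filt d N ≤ filt d (N + 1) := by
  induction N with
  | zero => exact bot_le
  | succ N ih => exact fun v hv => mem_filt_succ.2 fun i => ih (mem_filt_succ.1 hv i)

theorem filt_mono : Monotone (filt d) := monotone_nat_of_le_succ filt_le_succ

theorem invariants_le_filt : invariants d ≤ filt d 1 := fun _ hv =>
  mem_filt_succ.2 fun i => by rw [mem_invariants.1 hv i]; exact zero_mem _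

/-- The d_i commute, so a long word contains some d_i at least k_i times. The induction spends one
unit of k_i for each letter d_i applied. -/
theorem exists_mem_filt_of_pow (hcomm : ∀ i j v, d i (d j v) = d j (d i v)) (N : ℕ) :
    ∀ (k : Fin n → ℕ) (v : M), ∑ i, k i = N → (∀ i, (d i ^ k i) v = 0) → v ∈ filt d (N + 1) := by
  induction N with
  | zero =>
    intro k v hk hv
    refine mem_filt_succ.2 fun i => ?_
    have h0 : k i = 0 := by simpa using (Finset.sum_eq_zero_iff.1 hk) i (Finset.mem_univ i)
    have := hv i
    rw [h0, pow_zero] at this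
    rw [show v = 0 from this, map_zero]
    exact zero_mem _
  | succ N ih =>
    intro k v hk hv
    refine mem_filt_succ.2 fun i => ?_
    rcases Nat.eq_zero_or_pos (k i) with h0 | hpos
    · have := hv i
      rw [h0, pow_zero] at this
      rw [show v = 0 from this, map_zero]
      exact zero_mem _
    · refine ih (Function.update k i (k i - 1)) (d i v) ?_ fun j => ?_
      · have h1 := Finset.sum_update_of_mem (Finset.mem_univ i) k (k i - 1)
        have h2 := Finset.add_sum_erase Finset.univ k (Finset.mem_univ i)
        rw [← Finset.sdiff_singleton_eq_erase] at h2
        omega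
      · by_cases hj : j = i
        · subst hj
          rw [Function.update_self, ← Module.End.mul_apply, ← pow_succ, Nat.sub_add_cancel hpos]
          exact hv j
        · rw [Function.update_of_ne hj]
          have hc : Commute (d j) (d i) := LinearMap.ext fun v => hcomm j i v
          have := LinearMap.congr_fun (hc.pow_left (k j)).eq v
          rw [Module.End.mul_apply, Module.End.mul_apply, hv j, map_zero] at this
          exact this

theorem euler_mem {S : Submodule (A n) M} {v : M} (hv : ∀ i, d i v ∈ S) : euler d v ∈ S :=
  sum_mem fun i _ => S.smul_mem _ (hv i)

theorem euler_add (v w : M) : euler d (v + w) = euler d v + euler d w := by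
  simp [euler, Finset.sum_add_distrib]

theorem euler_sum {ι : Type*} (s : Finset ι) (v : ι → M) :
    euler d (∑ i ∈ s, v i) = ∑ i ∈ s, euler d (v i) := by
  simp only [euler, map_sum, Finset.smul_sum]
  exact Finset.sum_comm

namespace IsWeylAction

theorem apply_X_smul (hd : IsWeylAction d) (i j : Fin n) (v : M) :
    d i ((MvPolynomial.X j : A n) • v) =
      (if i = j then v else 0) + (MvPolynomial.X j : A n) • d i v := by
  rw [hd.leibniz]
  split_ifs with h
  · subst h; simp
  · rw [MvPolynomial.pderiv_X_of_ne (Ne.symm h), zero_smul]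

theorem apply_euler (hd : IsWeylAction d) (i : Fin n) (v : M) :
    d i (euler d v) = d i v + euler d (d i v) := by
  simp only [euler, map_sum, hd.apply_X_smul, Finset.sum_add_distrib, hd.comm i]
  simp

theorem euler_X_smul (hd : IsWeylAction d) (i : Fin n) (v : M) :
    euler d ((MvPolynomial.X i : A n) • v) =
      (MvPolynomial.X i : A n) • v + (MvPolynomial.X i : A n) • euler d v := by
  simp only [euler, hd.apply_X_smul, smul_add, Finset.sum_add_distrib, Finset.smul_sum, smul_ite,
    smul_zero]
  simp [smul_smul, mul_comm]

/-- The Euler operator E acts on the N-th graded piece as N, like the degree on polynomials: d_i E =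
(E + 1) d_i gives the induction step. -/
theorem euler_sub_smul_mem (hd : IsWeylAction d) (N : ℕ) :
    ∀ v ∈ filt d (N + 1), euler d v - (N : ℂ) • v ∈ filt d N := by
  induction N with
  | zero =>
    intro v hv
    have h : ∀ i, d i v = 0 := mem_filt_succ.1 hv
    rw [mem_filt_zero]
    simp [euler, h]
  | succ N ih =>
    intro v hv
    refine mem_filt_succ.2 fun i => ?_
    convert ih _ (mem_filt_succ.1 hv i) using 1
    rw [map_sub, hd.apply_euler, map_smul, Nat.cast_succ, add_smul, one_smul]
    abel

theorem X_smul_mem_filt (hd : IsWeylAction d) (j : Fin n) (N : ℕ) :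
    ∀ v ∈ filt d N, (MvPolynomial.X j : A n) • v ∈ filt d (N + 1) := by
  induction N with
  | zero =>
    intro v hv
    rw [mem_filt_zero.1 hv, smul_zero]
    exact zero_mem _
  | succ N ih =>
    intro v hv
    refine mem_filt_succ.2 fun i => ?_
    rw [hd.apply_X_smul]
    refine add_mem ?_ (ih _ (mem_filt_succ.1 hv i))
    split_ifs
    · exact hv
    · exact zero_mem _

theorem smul_mem_filt (hd : IsWeylAction d) (f : A n) :
    ∀ v : M, (∃ N, v ∈ filt d N) → ∃ N, f • v ∈ filt d N := by
  induction f using MvPolynomial.induction_on with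
  | C c =>
    rintro v ⟨N, hv⟩
    refine ⟨N, ?_⟩
    rw [← MvPolynomial.algebraMap_eq, algebraMap_smul]
    exact Submodule.smul_mem _ _ hv
  | add p q hp hq =>
    intro v hv
    obtain ⟨N, hN⟩ := hp v hv
    obtain ⟨N', hN'⟩ := hq v hv
    refine ⟨max N N', ?_⟩
    rw [add_smul]
    exact add_mem (filt_mono (le_max_left _ _) hN) (filt_mono (le_max_right _ _) hN')
  | mul_X p i hp =>
    rintro v ⟨N, hv⟩
    rw [mul_smul]
    exact hp _ ⟨N + 1, hd.X_smul_mem_filt i N v hv⟩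

theorem exists_mem_filt_of_span (hd : IsWeylAction d) {s : Set M} (hs : s ⊆ invariants d)
    (hspan : Submodule.span (A n) s = ⊤) (v : M) : ∃ N, v ∈ filt d N := by
  have hv : v ∈ Submodule.span (A n) s := hspan ▸ Submodule.mem_top
  induction hv using Submodule.span_induction with
  | mem v hv => exact ⟨1, invariants_le_filt (hs hv)⟩
  | zero => exact ⟨0, zero_mem _⟩
  | add v w _ _ hv hw =>
    obtain ⟨N, hN⟩ := hv
    obtain ⟨N', hN'⟩ := hw
    exact ⟨max N N', add_mem (filt_mono (le_max_left _ _) hN) (filt_mono (le_max_right _ _) hN')⟩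
  | smul f v _ hv => exact hd.smul_mem_filt f v hv

/-- For N > 0, v is recovered as N⁻¹(E v - (E v - N v)): E v is an A_n-combination of the d_i v, and
both these and the bracket lie one level lower. -/
theorem filt_le_of_invariants_le (hd : IsWeylAction d) {S : Submodule (A n) M}
    (hS : ∀ v ∈ invariants d, v ∈ S) (N : ℕ) : ∀ v ∈ filt d N, v ∈ S := by
  induction N with
  | zero => intro v hv; rw [mem_filt_zero.1 hv]; exact zero_mem _
  | succ N ih =>
    intro v hv
    rcases Nat.eq_zero_or_pos N with rfl | hN
    · exact hS v (mem_invariants.2 (mem_filt_succ.1 hv))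
    · have h1 : euler d v ∈ S := euler_mem fun i => ih _ (mem_filt_succ.1 hv i)
      have h2 := sub_mem h1 (ih _ (hd.euler_sub_smul_mem N v hv))
      rw [sub_sub_cancel] at h2
      have h3 := S.smul_of_tower_mem ((N : ℂ)⁻¹) h2
      rwa [inv_smul_smul₀ (by exact_mod_cast hN.ne')] at h3

variable (hd : IsWeylAction d) (hex : ∀ v, ∃ N, v ∈ filt d N)
include hd hex

theorem span_invariants : Submodule.span (A n) (invariants d : Set M) = ⊤ :=
  eq_top_iff.2 fun v _ =>
    let ⟨N, hN⟩ := hex v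
    hd.filt_le_of_invariants_le (fun _ hv => Submodule.subset_span hv) N v hN

omit hex in
-- Modulo S, v = ∑ t_i w_i and E v = 0, while E t_i = t_i (E + 1). Hence (N + 1) v = -∑ t_i (E w_i -
-- N w_i) modulo S, which replaces the w_i by vectors one level lower in the filtration, until they
-- vanish.
theorem mem_of_sub_sum_mem {S : Submodule (A n) M} (hS : ∀ i, ∀ v ∈ S, d i v ∈ S) {v : M}
    (hv : ∀ i, d i v ∈ S) (N : ℕ) :
    ∀ w : Fin n → M, (∀ i, w i ∈ filt d N) →
      v - ∑ i, (MvPolynomial.X i : A n) • w i ∈ S → v ∈ S := by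
  induction N with
  | zero =>
    intro w hw h
    have hw' : ∀ i, w i = 0 := hw
    simpa [hw'] using h
  | succ N ih =>
    intro w hw h
    refine ih (fun i => (-((N : ℂ) + 1)⁻¹) • (euler d (w i) - (N : ℂ) • w i))
      (fun i => Submodule.smul_mem _ _ (hd.euler_sub_smul_mem N _ (hw i))) ?_
    set s := v - ∑ i, (MvPolynomial.X i : A n) • w i with hs
    have hvs : v = s + ∑ i, (MvPolynomial.X i : A n) • w i := by rw [hs]; abel
    have hN : ((N : ℂ) + 1) ≠ 0 := by exact_mod_cast N.succ_ne_zero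
    have he : ∑ i, (MvPolynomial.X i : A n) • (euler d (w i) - (N : ℂ) • w i) =
        euler d v - euler d s - ((N : ℂ) + 1) • (v - s) := by
      have hvs' : v - s = ∑ i, (MvPolynomial.X i : A n) • w i := by rw [hs]; abel
      rw [hvs']
      conv_rhs => rw [hvs]
      simp only [euler_add, euler_sum, hd.euler_X_smul, smul_sub, Finset.sum_sub_distrib,
        Finset.sum_add_distrib, add_smul, one_smul, Finset.smul_sum,
        smul_comm (N : ℂ) (MvPolynomial.X _ : A n)]
      abel
    have : v - ∑ i, (MvPolynomial.X i : A n) •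
        ((-((N : ℂ) + 1)⁻¹) • (euler d (w i) - (N : ℂ) • w i)) =
        ((N : ℂ) + 1)⁻¹ • (euler d v - euler d s) + s := by
      simp only [smul_comm (MvPolynomial.X _ : A n) (-((N : ℂ) + 1)⁻¹), ← Finset.smul_sum, he]
      rw [neg_smul, smul_sub, inv_smul_smul₀ hN]
      abel
    rw [this]
    exact add_mem (S.smul_of_tower_mem _ (sub_mem (euler_mem hv) (euler_mem fun i => hS i s h))) h

/-- A vector which is constant modulo a Weyl submodule `S`, and lies in `S` at the origin, lies
in `S`. -/
theorem mem_of_mem_sup_augmentation {S : Submodule (A n) M} (hS : ∀ i, ∀ v ∈ S, d i v ∈ S) {v : M}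
    (hv : ∀ i, d i v ∈ S) (h : v ∈ S ⊔ augmentation n M) : v ∈ S := by
  obtain ⟨s, hs, x, hx, rfl⟩ := Submodule.mem_sup.1 h
  obtain ⟨w, rfl⟩ := mem_augmentation.1 hx
  choose N hN using fun i => hex (w i)
  -- The sum of the levels serves as a common bound for the finitely many `w i`.
  refine hd.mem_of_sub_sum_mem hS hv (∑ i, N i) w
    (fun i => filt_mono (Finset.single_le_sum (fun _ _ => Nat.zero_le _) (Finset.mem_univ i))
      (hN i)) ?_
  simpa using hs

/-- The uniqueness principle behind all later Taylor expansions: a constant is determined by its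
value at the origin. -/
theorem eq_zero_of_mem_augmentation {v : M} (hv : ∀ i, d i v = 0) (h : v ∈ augmentation n M) :
    v = 0 :=
  hd.mem_of_mem_sup_augmentation hex (S := ⊥)
    (fun i v hv => by rw [(Submodule.mem_bot _).1 hv, map_zero]; exact zero_mem _) hv
    (Submodule.mem_sup_right h)

theorem isCompl_invariants_augmentation :
    IsCompl (invariants d) ((augmentation n M).restrictScalars ℂ) := by
  refine ⟨Submodule.disjoint_def.2 fun v hv h =>
    hd.eq_zero_of_mem_augmentation hex (mem_invariants.1 hv) h, codisjoint_iff.2 ?_⟩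
  refine eq_top_iff.2 fun v _ => ?_
  have hv : v ∈ Submodule.span (A n) (invariants d : Set M) := by
    rw [hd.span_invariants hex]; trivial
  induction hv using Submodule.span_induction with
  | mem v hv => exact Submodule.mem_sup_left hv
  | zero => exact zero_mem _
  | add v w _ _ hv hw => exact add_mem (hv trivial) (hw trivial)
  | smul f v _ hv =>
    rw [← sub_add_cancel (f • v) (MvPolynomial.constantCoeff f • v)]
    exact add_mem (Submodule.mem_sup_right (smul_sub_constantCoeff_smul_mem f v))
      (Submodule.smul_mem _ _ (hv trivial))

end IsWeylAction

theorem isWeylAction_rTensor (V : Type*) [AddCommGroup V] [Module ℂ V] :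
    IsWeylAction (n := n) (M := A n ⊗[ℂ] V)
      fun i => ((del i : W n) : A n →ₗ[ℂ] A n).rTensor V where
  comm i j x := by
    induction x using TensorProduct.induction_on with
    | zero => simp
    | add x y hx hy => simp only [map_add, hx, hy]
    | tmul p v =>
      have h : del i (del j p) = del j (del i p) := by
        have := del_apply (del j : W n) i p
        rw [this, Finset.sum_eq_zero, add_zero]
        intro l _
        rw [MvPolynomial.pderiv_X, Pi.single_apply]
        split_ifs <;> simp
      simpa using congrArg (· ⊗ₜ[ℂ] v) h
  leibniz i f x := by
    induction x using TensorProduct.induction_on with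
    | zero => simp
    | add x y hx hy => simp only [smul_add, map_add, hx, hy]; abel
    | tmul p v =>
      simp only [TensorProduct.smul_tmul', LinearMap.rTensor_tmul, Derivation.coeFn_coe,
        smul_eq_mul, Derivation.leibniz, TensorProduct.add_tmul]
      rw [add_comm, mul_comm p]

theorem span_one_tmul (V : Type*) [AddCommGroup V] [Module ℂ V] :
    Submodule.span (A n) (Set.range fun v : V => (1 : A n) ⊗ₜ[ℂ] v) = ⊤ := by
  refine eq_top_iff.2 fun x _ => ?_
  induction x using TensorProduct.induction_on with
  | zero => exact zero_mem _
  | add x y hx hy => exact add_mem (hx trivial) (hy trivial)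
  | tmul p v =>
    have : p ⊗ₜ[ℂ] v = p • ((1 : A n) ⊗ₜ[ℂ] v) := by
      rw [TensorProduct.smul_tmul', smul_eq_mul, mul_one]
    rw [this]
    exact Submodule.smul_mem _ _ (Submodule.subset_span ⟨v, rfl⟩)

variable (d) in
/-- The multiplication map `A_n ⊗ M^d → M`. -/
def ofInvariants : A n ⊗[ℂ] invariants d →ₗ[A n] M :=
  TensorProduct.AlgebraTensorModule.lift
    ((LinearMap.lsmul (A n) M).flip.restrictScalars ℂ ∘ₗ (invariants d).subtype).flip

end WeylAction

/-! ### The isomorphism A_n ⊗ M^d → M -/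

section Decomposition

variable {n : ℕ} {M : Type*} [AddCommGroup M] [Module ℂ M] [Module (A n) M]
  [IsScalarTower ℂ (A n) M] {d : Fin n → Module.End ℂ M}

theorem ofInvariants_tmul (p : A n) (v : invariants d) :
    ofInvariants d (p ⊗ₜ[ℂ] v) = p • (v : M) := rfl

theorem ofInvariants_rTensor (hd : IsWeylAction d) (i : Fin n) (x : A n ⊗[ℂ] invariants d) :
    ofInvariants d (((del i : W n) : A n →ₗ[ℂ] A n).rTensor _ x) = d i (ofInvariants d x) := by
  induction x using TensorProduct.induction_on with
  | zero => simp
  | add x y hx hy => simp only [map_add, hx, hy]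
  | tmul p v =>
    rw [LinearMap.rTensor_tmul, ofInvariants_tmul, ofInvariants_tmul, hd.leibniz,
      mem_invariants.1 v.2 i, smul_zero, add_zero]
    rfl

theorem one_tmul_mem_invariants (V : Type*) [AddCommGroup V] [Module ℂ V] (v : V) :
    (1 : A n) ⊗ₜ[ℂ] v ∈
      invariants fun i => ((del i : W n) : A n →ₗ[ℂ] A n).rTensor V := by
  refine mem_invariants.2 fun i => ?_
  rw [LinearMap.rTensor_tmul]
  simp

theorem exists_mem_filt_rTensor (V : Type*) [AddCommGroup V] [Module ℂ V] (x : A n ⊗[ℂ] V) :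
    ∃ N, x ∈ filt (fun i => ((del i : W n) : A n →ₗ[ℂ] A n).rTensor V) N :=
  (isWeylAction_rTensor V).exists_mem_filt_of_span
    (Set.range_subset_iff.2 (one_tmul_mem_invariants V)) (span_one_tmul V) x

theorem sub_one_tmul_mem_augmentation (V : Type*) [AddCommGroup V] [Module ℂ V]
    (x : A n ⊗[ℂ] V) : ∃ v : V, x - (1 : A n) ⊗ₜ[ℂ] v ∈ augmentation n (A n ⊗[ℂ] V) := by
  induction x using TensorProduct.induction_on with
  | zero => exact ⟨0, by simp⟩
  | add x y hx hy =>
    obtain ⟨v, hv⟩ := hx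
    obtain ⟨w, hw⟩ := hy
    refine ⟨v + w, ?_⟩
    rw [TensorProduct.tmul_add, add_sub_add_comm]
    exact add_mem hv hw
  | tmul p v =>
    refine ⟨MvPolynomial.constantCoeff p • v, ?_⟩
    convert smul_sub_constantCoeff_smul_mem p ((1 : A n) ⊗ₜ[ℂ] v) using 2
    · rw [TensorProduct.smul_tmul', smul_eq_mul, mul_one]
    · rw [TensorProduct.tmul_smul]

/-- The kernel is stable under the derivations. By induction on the level, all derivatives of a
kernel element vanish, so it is a constant 1 ⊗ v, whose image is v. -/
theorem ofInvariants_injective (hd : IsWeylAction d) : Function.Injective (ofInvariants d) := by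
  have key (N : ℕ) : ∀ x ∈ filt (fun i =>
      ((del i : W n) : A n →ₗ[ℂ] A n).rTensor (invariants d)) N,
      ofInvariants d x = 0 → x = 0 := by
    induction N with
    | zero => exact fun x hx _ => hx
    | succ N ih =>
      intro x hx h0
      have hx' : ∀ i, ((del i : W n) : A n →ₗ[ℂ] A n).rTensor (invariants d) x = 0 := fun i =>
        ih _ (mem_filt_succ.1 hx i) (by rw [ofInvariants_rTensor hd, h0, map_zero])
      obtain ⟨v, hv⟩ := sub_one_tmul_mem_augmentation _ x
      have := (isWeylAction_rTensor (invariants d)).eq_zero_of_mem_augmentation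
        (exists_mem_filt_rTensor _) (fun i => by
          rw [map_sub, hx', mem_invariants.1 (one_tmul_mem_invariants _ v) i, sub_zero]) hv
      rw [sub_eq_zero] at this
      rw [this, ofInvariants_tmul, one_smul] at h0
      rw [this, Subtype.ext (a2 := (0 : invariants d)) h0, TensorProduct.tmul_zero]
  refine (injective_iff_map_eq_zero _).2 fun x hx => ?_
  obtain ⟨N, hN⟩ := exists_mem_filt_rTensor _ x
  exact key N x hN hx

theorem ofInvariants_surjective (hd : IsWeylAction d) (hex : ∀ v, ∃ N, v ∈ filt d N) :
    Function.Surjective (ofInvariants d) := by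
  rw [← LinearMap.range_eq_top, eq_top_iff, ← hd.span_invariants hex, Submodule.span_le]
  intro v hv
  exact ⟨1 ⊗ₜ[ℂ] ⟨v, hv⟩, by rw [ofInvariants_tmul, one_smul]⟩

end Decomposition

/-! ### Polynomial vector fields and their order of vanishing at the origin -/

section VectorFields

variable {n : ℕ}

theorem del_del_X (l k : Fin n) (D : W n) :
    D (del l (MvPolynomial.X k)) = 0 := by
  rw [MvPolynomial.pderiv_X, Pi.single_apply]
  split_ifs <;> simp

theorem lie_del_apply_X (D : W n) (i k : Fin n) :
    ⁅(del i : W n), D⁆ (MvPolynomial.X k) = del i (D (MvPolynomial.X k)) := by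
  rw [Derivation.commutator_apply, del_del_X, sub_zero]

theorem lie_del_del (i j : Fin n) : ⁅(del i : W n), (del j : W n)⁆ = 0 :=
  MvPolynomial.derivation_ext fun k => by
    rw [lie_del_apply_X, del_del_X]; rfl

theorem del_comm (i j : Fin n) (f : A n) : del i (del j f) = del j (del i f) := by
  have := congrArg (fun D : W n => D f) (lie_del_del i j)
  rw [Derivation.commutator_apply] at this
  exact sub_eq_zero.1 this

/-- The operators `ad ∂_i` on `W_n`. -/
def adDel (i : Fin n) : Module.End ℂ (W n) := LieModule.toEnd ℂ (W n) (W n) (del i)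

theorem adDel_apply (i : Fin n) (D : W n) : adDel i D = ⁅(del i : W n), D⁆ := rfl

/-- W_n is itself a Weyl module, so the results above apply to it. Here `filt adDel N` consists of
the fields with coefficients of degree less than N, and induction on N is induction on the degree.
-/
theorem isWeylAction_adDel : IsWeylAction (adDel (n := n)) where
  comm i j D := by
    refine MvPolynomial.derivation_ext fun k => ?_
    simp only [adDel_apply, lie_del_apply_X]
    exact del_comm i j _
  leibniz i f D := by
    refine MvPolynomial.derivation_ext fun k => ?_
    rw [adDel_apply, adDel_apply, lie_del_apply_X, Derivation.add_apply, Derivation.smul_apply,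
      Derivation.smul_apply, Derivation.smul_apply, lie_del_apply_X, smul_eq_mul,
      Derivation.leibniz, smul_eq_mul, smul_eq_mul, smul_eq_mul, add_comm, mul_comm (D _)]

theorem sum_smul_del_apply_X (f : Fin n → A n) (k : Fin n) :
    (∑ l, f l • (del l : W n)) (MvPolynomial.X k) = f k := by
  rw [← Derivation.coeFnAddMonoidHom_apply, map_sum, Finset.sum_apply, Finset.sum_eq_single k]
  · simp
  · intro b _ hb
    simp [MvPolynomial.pderiv_X_of_ne hb.symm]
  · simp

theorem eq_sum_smul_del (D : W n) : D = ∑ l, D (MvPolynomial.X l) • (del l : W n) :=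
  MvPolynomial.derivation_ext fun k =>
    (sum_smul_del_apply_X (fun l => D (MvPolynomial.X l)) k).symm

theorem exists_mem_filt_adDel (D : W n) : ∃ N, D ∈ filt adDel N := by
  refine isWeylAction_adDel.exists_mem_filt_of_span (s := Set.range del)
    (Set.range_subset_iff.2 fun j => mem_invariants.2 fun i => lie_del_del i j) ?_ D
  refine eq_top_iff.2 fun D _ => ?_
  rw [eq_sum_smul_del D]
  exact sum_mem fun l _ => Submodule.smul_mem _ _ (Submodule.subset_span ⟨l, rfl⟩)

/-- The vector field `D` vanishes at the origin. -/
def Vanishes (D : W n) : Prop :=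
  ∀ k, MvPolynomial.constantCoeff (D (MvPolynomial.X k)) = 0

/-- The vector field `D` vanishes at the origin to order two. -/
def VanishesTwice (D : W n) : Prop :=
  Vanishes D ∧ ∀ i k, MvPolynomial.constantCoeff (del i (D (MvPolynomial.X k))) = 0

theorem Vanishes.constantCoeff_apply {D : W n} (hD : Vanishes D) (f : A n) :
    MvPolynomial.constantCoeff (D f) = 0 := by
  rw [apply_eq_sum, map_sum]
  exact Finset.sum_eq_zero fun l _ => by rw [map_mul, hD l, zero_mul]

theorem Vanishes.lie {D E : W n} (hD : Vanishes D) (hE : Vanishes E) : Vanishes ⁅D, E⁆ := fun k => by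
  rw [Derivation.commutator_apply, map_sub, hD.constantCoeff_apply, hE.constantCoeff_apply,
    sub_zero]

theorem Vanishes.add {D E : W n} (hD : Vanishes D) (hE : Vanishes E) : Vanishes (D + E) := fun k => by
  rw [Derivation.add_apply, map_add, hD k, hE k, add_zero]

theorem VanishesTwice.add {D E : W n} (hD : VanishesTwice D) (hE : VanishesTwice E) :
    VanishesTwice (D + E) :=
  ⟨hD.1.add hE.1, fun i k => by
    rw [Derivation.add_apply, map_add, map_add, hD.2, hE.2, add_zero]⟩

theorem VanishesTwice.smul {D : W n} (c : ℂ) (hD : VanishesTwice D) : VanishesTwice (c • D) :=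
  ⟨fun k => by
    rw [Derivation.smul_apply, MvPolynomial.smul_eq_C_mul, map_mul, hD.1 k, mul_zero], fun i k => by
    rw [Derivation.smul_apply, Derivation.map_smul, MvPolynomial.smul_eq_C_mul, map_mul, hD.2 i k,
      mul_zero]⟩

/-- Fields vanishing to order two form an ideal among those vanishing at the origin; the quotient is
gl_n. -/
theorem VanishesTwice.lie {D E : W n} (hD : VanishesTwice D) (hE : Vanishes E) :
    VanishesTwice ⁅D, E⁆ :=
  ⟨hD.1.lie hE, fun i k => by
    rw [del_lie]
    simp [hD.1.constantCoeff_apply, hE.constantCoeff_apply, hD.2]⟩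

/-- The linear vector field `∑ b_ik t_i ∂_k`. -/
def linField : Gl n →ₗ[ℂ] W n where
  toFun B := ∑ k, (∑ i, B i k • (MvPolynomial.X i : A n)) • (del k : W n)
  map_add' B C := by
    simp only [Matrix.add_apply, add_smul, Finset.sum_add_distrib]
  map_smul' c B := by
    rw [RingHom.id_apply, Finset.smul_sum]
    simp only [Matrix.smul_apply, ← smul_assoc, Finset.smul_sum]

theorem linField_apply_X (B : Gl n) (k : Fin n) :
    linField B (MvPolynomial.X k) = ∑ i, B i k • (MvPolynomial.X i : A n) :=
  sum_smul_del_apply_X _ k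

theorem del_linField_apply_X (B : Gl n) (i k : Fin n) :
    del i (linField B (MvPolynomial.X k)) = MvPolynomial.C (B i k) := by
  rw [linField_apply_X, map_sum, Finset.sum_eq_single i]
  · simp [MvPolynomial.smul_eq_C_mul]
  · intro j _ hj
    simp [MvPolynomial.pderiv_X_of_ne hj]
  · simp

theorem vanishes_linField (B : Gl n) : Vanishes (linField B) := fun k => by
  rw [linField_apply_X]
  simp [MvPolynomial.smul_eq_C_mul]

theorem linField_lie (B C : Gl n) : linField ⁅B, C⁆ = ⁅linField B, linField C⁆ := by
  refine MvPolynomial.derivation_ext fun k => ?_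
  rw [Derivation.commutator_apply]
  simp only [linField_apply_X, map_sum, Derivation.map_smul, Finset.smul_sum, smul_smul]
  rw [Finset.sum_comm, Finset.sum_comm (γ := Fin n) (f := fun x y => (B x k * C y x) • _)]
  simp only [← Finset.sum_smul, ← Finset.sum_sub_distrib, ← sub_smul]
  refine Finset.sum_congr rfl fun i _ => ?_
  rw [LieRing.of_associative_ring_bracket, Matrix.sub_apply, Matrix.mul_apply, Matrix.mul_apply]
  simp only [Finset.sum_sub_distrib, mul_comm]

/-- The matrix of the linear part of a vector field. -/
def linearPart (D : W n) : Gl n :=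
  Matrix.of fun i k => MvPolynomial.constantCoeff (del i (D (MvPolynomial.X k)))

/-- Modulo second order, a vector field vanishing at the origin is linear. -/
theorem Vanishes.vanishesTwice_sub {D : W n} (hD : Vanishes D) : VanishesTwice
    (D - linField (linearPart D)) := by
  refine ⟨fun k => ?_, fun i k => ?_⟩
  · rw [Derivation.sub_apply, map_sub, hD k, vanishes_linField _ k, sub_zero]
  · rw [Derivation.sub_apply, map_sub, map_sub, del_linField_apply_X, MvPolynomial.constantCoeff_C,
      linearPart, Matrix.of_apply, sub_self]

theorem vanishes_sub (D : W n) : Vanishes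
    (D - ∑ k, MvPolynomial.constantCoeff (D (MvPolynomial.X k)) • (del k : W n)) := fun k => by
  have h : ∑ k, MvPolynomial.constantCoeff (D (MvPolynomial.X k)) • (del k : W n) =
      ∑ k, (MvPolynomial.C (MvPolynomial.constantCoeff (D (MvPolynomial.X k))) : A n) •
        (del k : W n) :=
    Finset.sum_congr rfl fun k _ => by rw [← MvPolynomial.algebraMap_eq, algebraMap_smul]
  rw [h, Derivation.sub_apply, sum_smul_del_apply_X, map_sub, MvPolynomial.constantCoeff_C,
    sub_self]

variable (n) in
/-- The Euler vector field. -/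
def eulerField : W n := linField 1

theorem eulerField_apply_X (k : Fin n) :
    eulerField n (MvPolynomial.X k) = (MvPolynomial.X k : A n) := by
  simp [eulerField, linField_apply_X, Matrix.one_apply]

theorem vanishes_eulerField : Vanishes (eulerField n) := vanishes_linField 1

/-- The weight of a homogeneous field is the degree of its coefficients minus one, the shift coming
from ∂_k. -/
theorem eulerField_lie (D : W n) : ⁅eulerField n, D⁆ = euler adDel D - D := by
  refine MvPolynomial.derivation_ext fun k => ?_
  rw [Derivation.commutator_apply, Derivation.sub_apply, eulerField_apply_X, apply_eq_sum, euler,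
    ← Derivation.coeFnAddMonoidHom_apply (∑ i, _), map_sum, Finset.sum_apply]
  congr 1
  refine Finset.sum_congr rfl fun i _ => ?_
  rw [eulerField_apply_X, Derivation.coeFnAddMonoidHom_apply, Derivation.smul_apply, adDel_apply,
    lie_del_apply_X, smul_eq_mul]

theorem Vanishes.mem_augmentation {D : W n} (hD : Vanishes D) : D ∈ augmentation n (W n) := by
  rw [eq_sum_smul_del D]
  exact sum_mem fun l _ => smul_mem_augmentation (hD l) _

/-- Coefficients of degree at most one have no second-order part. The uniqueness principle is used
first for D, then for each [∂_i, D]. -/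
theorem VanishesTwice.eq_zero_of_mem_filt {D : W n} (hD : VanishesTwice D)
    (h : D ∈ filt adDel 2) : D = 0 := by
  refine isWeylAction_adDel.eq_zero_of_mem_augmentation exists_mem_filt_adDel (fun i => ?_)
    hD.1.mem_augmentation
  refine isWeylAction_adDel.eq_zero_of_mem_augmentation exists_mem_filt_adDel
    (fun j => mem_filt_succ.1 (mem_filt_succ.1 h i) j) ?_
  refine Vanishes.mem_augmentation fun k => ?_
  rw [adDel_apply, lie_del_apply_X]
  exact hD.2 i k

end VectorFields

/-! ### The fibre at the origin as a module over the fields vanishing there -/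

section Origin

variable {n : ℕ} (a : Fin n → ℂ) {M : Type*} [AddCommGroup M] [Module ℂ M] [Module (A n) M]
  [LieRingModule (W n) M] [IsAWModule n M]

variable (M) in
/-- The operators `∂_i - a_i`. -/
def shiftedDel (i : Fin n) : Module.End ℂ M := LieModule.toEnd ℂ (W n) M (del i) - a i • 1

theorem shiftedDel_apply (i : Fin n) (v : M) :
    shiftedDel a M i v = ⁅(del i : W n), v⁆ - a i • v := rfl

theorem isWeylAction_shiftedDel : IsWeylAction (shiftedDel a M) where
  comm i j v := by
    have h : ⁅(del i : W n), ⁅(del j : W n), v⁆⁆ = ⁅(del j : W n), ⁅(del i : W n), v⁆⁆ := by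
      rw [leibniz_lie, lie_del_del, zero_lie, zero_add]
    simp only [shiftedDel_apply, lie_sub, lie_smul, smul_sub, h, smul_comm (a i) (a j)]
    abel
  leibniz i f v := by
    rw [shiftedDel_apply, shiftedDel_apply, IsAWModule.lie_smul_eq, smul_sub, smul_comm f (a i)]
    abel

theorem shiftedDel_lie (i : Fin n) (D : W n) (v : M) :
    shiftedDel a M i ⁅D, v⁆ = ⁅⁅(del i : W n), D⁆, v⁆ + ⁅D, shiftedDel a M i v⁆ := by
  rw [shiftedDel_apply, shiftedDel_apply, leibniz_lie, lie_sub, lie_smul]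
  abel

variable {a}

theorem lie_del_of_mem_invariants {v : M} (hv : v ∈ invariants (shiftedDel a M)) (i : Fin n) :
    ⁅(del i : W n), v⁆ = a i • v :=
  sub_eq_zero.1 (mem_invariants.1 hv i)

theorem shiftedDel_lie_of_mem_invariants {v : M} (hv : v ∈ invariants (shiftedDel a M))
    (i : Fin n) (D : W n) : shiftedDel a M i ⁅D, v⁆ = ⁅⁅(del i : W n), D⁆, v⁆ := by
  rw [shiftedDel_lie, mem_invariants.1 hv i, lie_zero, add_zero]

theorem Vanishes.lie_mem_augmentation {D : W n} (hD : Vanishes D) {v : M}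
    (hv : v ∈ augmentation n M) : ⁅D, v⁆ ∈ augmentation n M := by
  obtain ⟨w, rfl⟩ := WittWhittaker.mem_augmentation.1 hv
  rw [lie_sum]
  refine sum_mem fun i _ => ?_
  rw [IsAWModule.lie_smul_eq]
  exact add_mem (smul_mem_augmentation (hD i) _) (X_smul_mem_augmentation i _)

/-- Transfers finite-dimensionality from Wh_a(M) to the constants; only this inclusion is needed. -/
theorem invariants_le_Wh : invariants (shiftedDel a M) ≤ Wh a M := by
  intro v hv x
  have h : ∀ x ∈ Delta n, ⁅x, v⁆ =
      (∑ i, a i * MvPolynomial.constantCoeff (x (MvPolynomial.X i))) • v := by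
    intro x hx
    have hlin (D : W n) : ∑ i, MvPolynomial.constantCoeff (D (MvPolynomial.X i)) •
        ⁅(del i : W n), v⁆ = (∑ i, a i * MvPolynomial.constantCoeff (D (MvPolynomial.X i))) • v := by
      rw [Finset.sum_smul]
      exact Finset.sum_congr rfl fun i _ => by
        rw [lie_del_of_mem_invariants hv, smul_smul, mul_comm]
    rw [← hlin]
    induction hx using Submodule.span_induction with
    | mem x hx =>
      obtain ⟨j, rfl⟩ := hx
      rw [Finset.sum_eq_single j]
      · simp
      · intro i _ hi
        simp [MvPolynomial.pderiv_X_of_ne hi]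
      · simp
    | zero => simp
    | add x y _ _ hx hy =>
      simp only [add_lie, hx, hy, Derivation.add_apply, map_add, add_smul, Finset.sum_add_distrib]
    | smul c x _ hx =>
      simp only [smul_lie, hx, Derivation.smul_apply, MvPolynomial.smul_eq_C_mul, map_mul,
        MvPolynomial.constantCoeff_C, Finset.smul_sum, smul_smul]
  exact h x x.2

theorem exists_mem_filt_shiftedDel (hwhit : IsWhittakerOfType a M) (v : M) :
    ∃ N, v ∈ filt (shiftedDel a M) N := by
  obtain ⟨k, hk⟩ := hwhit.2 v
  refine ⟨_, exists_mem_filt_of_pow (isWeylAction_shiftedDel a).comm _ (fun _ => k) v rfl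
    fun i => ?_⟩
  rw [Module.End.pow_apply]
  convert hk ⟨del i, Submodule.subset_span ⟨i, rfl⟩⟩ using 2
  funext w
  rw [shifted, phi_del, shiftedDel_apply]

variable (hex : ∀ v, ∃ N, v ∈ filt (shiftedDel a M) N)

/-- The projection of `M` onto the constants along `∑ t_i M`, i.e. evaluation at the origin. -/
def evalOrigin : M →ₗ[ℂ] invariants (shiftedDel a M) :=
  (invariants (shiftedDel a M)).projectionOnto _
    ((isWeylAction_shiftedDel a).isCompl_invariants_augmentation hex)

theorem evalOrigin_eq_zero_iff {v : M} : evalOrigin hex v = 0 ↔ v ∈ augmentation n M :=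
  Submodule.projectionOnto_apply_eq_zero_iff _

theorem evalOrigin_coe (v : invariants (shiftedDel a M)) : evalOrigin hex (v : M) = v :=
  Submodule.projectionOnto_apply_left _ v

theorem sub_evalOrigin_mem (v : M) : v - (evalOrigin hex v : M) ∈ augmentation n M := by
  rw [← evalOrigin_eq_zero_iff hex, map_sub, evalOrigin_coe, sub_self]

theorem evalOrigin_smul (f : A n) (v : M) :
    evalOrigin hex (f • v) = MvPolynomial.constantCoeff f • evalOrigin hex v := by
  rw [← sub_eq_zero, ← map_smul, ← map_sub, evalOrigin_eq_zero_iff]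
  exact smul_sub_constantCoeff_smul_mem f v

/-- D preserves ∑ t_i M, so an inner evaluation can be dropped. This makes `originAction`
multiplicative on vanishing fields. -/
theorem Vanishes.evalOrigin_lie {D : W n} (hD : Vanishes D) (v : M) :
    evalOrigin hex ⁅D, (evalOrigin hex v : M)⁆ = evalOrigin hex ⁅D, v⁆ := by
  rw [eq_comm, ← sub_eq_zero, ← map_sub, ← lie_sub, evalOrigin_eq_zero_iff]
  exact hD.lie_mem_augmentation (sub_evalOrigin_mem hex v)

/-- The action of vector fields on the fibre of `M` at the origin. It is a representation of the
vector fields which vanish there. -/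
def originAction : W n →ₗ[ℂ] Module.End ℂ (invariants (shiftedDel a M)) where
  toFun D := evalOrigin hex ∘ₗ LieModule.toEnd ℂ (W n) M D ∘ₗ Submodule.subtype _
  map_add' D E := LinearMap.ext fun v => by simp
  map_smul' c D := LinearMap.ext fun v => by simp

theorem originAction_apply (D : W n) (v : invariants (shiftedDel a M)) :
    originAction hex D v = evalOrigin hex ⁅D, (v : M)⁆ := rfl

theorem Vanishes.originAction_lie {D E : W n} (hD : Vanishes D) (hE : Vanishes E)
    (v : invariants (shiftedDel a M)) :
    originAction hex ⁅D, E⁆ v =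
      originAction hex D (originAction hex E v) - originAction hex E (originAction hex D v) := by
  simp only [originAction_apply, hD.evalOrigin_lie, hE.evalOrigin_lie]
  rw [← map_sub, lie_lie]

theorem originAction_del (i : Fin n) (v : invariants (shiftedDel a M)) :
    originAction hex (del i) v = a i • v := by
  rw [originAction_apply, lie_del_of_mem_invariants v.2, map_smul, evalOrigin_coe]

/-- Any field is a vanishing one plus a constant one, and ∂_i acts on the fibre by the scalar a_i.
-/
theorem originAction_mem {N : Submodule ℂ (invariants (shiftedDel a M))}
    (hN : ∀ D, Vanishes D → ∀ v ∈ N, originAction hex D v ∈ N) (D : W n)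
    {v : invariants (shiftedDel a M)} (hv : v ∈ N) : originAction hex D v ∈ N := by
  rw [← sub_add_cancel D (∑ k, MvPolynomial.constantCoeff (D (MvPolynomial.X k)) • (del k : W n)),
    map_add, map_sum]
  simp only [map_smul, LinearMap.add_apply, LinearMap.sum_apply, LinearMap.smul_apply,
    originAction_del]
  exact add_mem (hN _ (vanishes_sub D) v hv)
    (sum_mem fun k _ => N.smul_mem _ (N.smul_mem _ hv))

include hex in
theorem nontrivial_invariants [Nontrivial M] : Nontrivial (invariants (shiftedDel a M)) := by
  rw [Submodule.nontrivial_iff_ne_bot]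
  intro h
  have := (isWeylAction_shiftedDel a).span_invariants hex
  rw [h] at this
  simp at this

/-- The fibre at the origin of a simple module is a simple module over the vector fields which
vanish there. -/
theorem eq_bot_or_eq_top_of_originAction_mem (hsimple : IsSimpleAWModule n M)
    (N : Submodule ℂ (invariants (shiftedDel a M)))
    (hN : ∀ D, Vanishes D → ∀ v ∈ N, originAction hex D v ∈ N) : N = ⊥ ∨ N = ⊤ := by
  have hd := isWeylAction_shiftedDel a (M := M)
  set S : Submodule (A n) M := Submodule.span (A n) (Subtype.val '' (N : Set (invariants (shiftedDel a M)))) with hS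
  have hNS : ∀ v ∈ N, (v : M) ∈ S := fun v hv => Submodule.subset_span ⟨v, hv, rfl⟩
  have hdS : ∀ i, ∀ v ∈ S, shiftedDel a M i v ∈ S := by
    intro i v hv
    induction hv using Submodule.span_induction with
    | mem v hv =>
      obtain ⟨w, _, rfl⟩ := hv
      rw [mem_invariants.1 w.2 i]
      exact zero_mem _
    | zero => rw [map_zero]; exact zero_mem _
    | add v w _ _ hv hw => rw [map_add]; exact add_mem hv hw
    | smul f v hv' hv =>
      rw [hd.leibniz]
      exact add_mem (S.smul_mem _ hv') (S.smul_mem _ hv)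
  -- Induction on the degree of D: the derivatives of D v are [∂_i, D] v, in S by induction, and the
  -- value of D v at the origin lies in N.
  have hlieN (k : ℕ) : ∀ D ∈ filt (adDel (n := n)) k, ∀ v ∈ N, ⁅D, (v : M)⁆ ∈ S := by
    induction k with
    | zero =>
      intro D hD v _
      rw [mem_filt_zero.1 hD, zero_lie]
      exact zero_mem _
    | succ k ih =>
      intro D hD v hv
      refine hd.mem_of_mem_sup_augmentation hex hdS (fun i => ?_) ?_
      · rw [shiftedDel_lie_of_mem_invariants v.2]
        exact ih _ (mem_filt_succ.1 hD i) v hv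
      · rw [← add_sub_cancel (evalOrigin hex ⁅D, (v : M)⁆ : M) ⁅D, (v : M)⁆]
        exact add_mem (Submodule.mem_sup_left (hNS _ (originAction_mem hex hN D hv)))
          (Submodule.mem_sup_right (sub_evalOrigin_mem hex _))
  have hlieS : ∀ (D : W n), ∀ v ∈ S, ⁅D, v⁆ ∈ S := by
    intro D v hv
    induction hv using Submodule.span_induction with
    | mem v hv =>
      obtain ⟨w, hw, rfl⟩ := hv
      obtain ⟨k, hk⟩ := exists_mem_filt_adDel D
      exact hlieN k D hk w hw
    | zero => rw [lie_zero]; exact zero_mem _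
    | add v w _ _ hv hw => rw [lie_add]; exact add_mem hv hw
    | smul f v hv' hv =>
      rw [IsAWModule.lie_smul_eq]
      exact add_mem (S.smul_mem _ hv') (S.smul_mem _ hv)
  -- S evaluates into N, so S = ⊤ forces N = ⊤.
  have hevS : ∀ v ∈ S, evalOrigin hex v ∈ N := by
    intro v hv
    induction hv using Submodule.span_induction with
    | mem v hv =>
      obtain ⟨w, hw, rfl⟩ := hv
      rwa [evalOrigin_coe]
    | zero => rw [map_zero]; exact zero_mem _
    | add v w _ _ hv hw => rw [map_add]; exact add_mem hv hw
    | smul f v _ hv =>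
      rw [evalOrigin_smul]
      exact N.smul_mem _ hv
  rcases hsimple.2 S hlieS with h | h
  · refine Or.inl ((Submodule.eq_bot_iff _).2 fun v hv => Subtype.ext ?_)
    have := hNS v hv
    rwa [h] at this
  · refine Or.inr (eq_top_iff.2 fun v _ => ?_)
    have := hevS v (h ▸ Submodule.mem_top)
    rwa [evalOrigin_coe] at this

/-- The top-degree part of D has weight m + 1 under the Euler field. The rest kills v by induction,
so D v would be an eigenvector with eigenvalue c + m + 1. -/
theorem originAction_eq_zero_of_eigenvector {v : invariants (shiftedDel a M)} {c : ℂ}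
    (hv : originAction hex (eulerField n) v = c • v)
    (hc : ∀ m : ℕ, 0 < m → ¬ (originAction hex (eulerField n)).HasEigenvalue (c + m)) (N : ℕ) :
    ∀ D ∈ filt (adDel (n := n)) N, VanishesTwice D → originAction hex D v = 0 := by
  induction N with
  | zero =>
    intro D hD _
    rw [mem_filt_zero.1 hD, map_zero, LinearMap.zero_apply]
  | succ N ih =>
    intro D hD h2
    rcases Nat.lt_or_ge N 2 with hN | hN
    · rw [h2.eq_zero_of_mem_filt (filt_mono (by omega) hD), map_zero, LinearMap.zero_apply]
    -- Top degree N = m + 2 means weight N - 1 = m + 1, which is positive.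
    · obtain ⟨m, rfl⟩ : ∃ m, N = m + 2 := ⟨N - 2, by omega⟩
      have hlie : ⁅eulerField n, D⁆ - ((m + 1 : ℕ) : ℂ) • D =
          euler adDel D - ((m + 2 : ℕ) : ℂ) • D := by
        rw [eulerField_lie]
        push_cast
        module
      have h := ih (⁅eulerField n, D⁆ - ((m + 1 : ℕ) : ℂ) • D)
        (hlie ▸ isWeylAction_adDel.euler_sub_smul_mem _ D hD) (by
          have h1 := (h2.lie vanishes_eulerField).smul (-1)
          have h3 : ⁅eulerField n, D⁆ - ((m + 1 : ℕ) : ℂ) • D =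
              (-1 : ℂ) • ⁅D, eulerField n⁆ + (-((m + 1 : ℕ) : ℂ)) • D := by
            rw [← lie_skew (eulerField n) D]
            module
          rw [h3]
          exact h1.add (h2.smul _))
      rw [map_sub, LinearMap.sub_apply, vanishes_eulerField.originAction_lie hex h2.1, hv, map_smul,
        map_smul, LinearMap.smul_apply, sub_sub, ← add_smul, sub_eq_zero] at h
      by_contra hne
      exact hc (m + 1) m.succ_pos (Module.End.hasEigenvalue_of_hasEigenvector
        ⟨Module.End.mem_eigenspace_iff.2 h, hne⟩)

/-- An eigenvalue of maximal real part works, since there are finitely many. -/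
theorem exists_eigenvalue_forall_add_natCast_not {V : Type*} [AddCommGroup V] [Module ℂ V]
    [FiniteDimensional ℂ V] [Nontrivial V] (f : Module.End ℂ V) :
    ∃ c, f.HasEigenvalue c ∧ ∀ m : ℕ, 0 < m → ¬ f.HasEigenvalue (c + m) := by
  obtain ⟨c, hc, hmax⟩ := Set.exists_max_image {c | f.HasEigenvalue c} Complex.re
    f.finite_hasEigenvalue f.exists_eigenvalue
  refine ⟨c, hc, fun m hm h => ?_⟩
  have := hmax _ h
  simp only [Complex.add_re, Complex.natCast_re] at this
  have : (0 : ℝ) < m := by exact_mod_cast hm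
  linarith

/-- Vector fields vanishing to order two act trivially on the fibre of a simple module. -/
theorem VanishesTwice.originAction_eq_zero (hsimple : IsSimpleAWModule n M)
    [FiniteDimensional ℂ (invariants (shiftedDel a M))] {D : W n} (hD : VanishesTwice D) :
    originAction hex D = 0 := by
  have := hsimple.1
  have := nontrivial_invariants hex
  obtain ⟨c, hc, hmax⟩ :=
    exists_eigenvalue_forall_add_natCast_not (originAction hex (eulerField n))
  obtain ⟨v, hv⟩ := hc.exists_hasEigenvector
  -- The common kernel of the fields vanishing to order two: nonzero by the eigenvector, stable by
  -- the ideal property, hence everything.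
  let U : Submodule ℂ (invariants (shiftedDel a M)) :=
    ⨅ E : {E : W n // VanishesTwice E}, LinearMap.ker (originAction hex E.1)
  have hU {w} : w ∈ U ↔ ∀ E, VanishesTwice E → originAction hex E w = 0 := by
    simp [U, Submodule.mem_iInf]
  have hvU : v ∈ U := hU.2 fun E hE =>
    let ⟨N, hN⟩ := exists_mem_filt_adDel E
    originAction_eq_zero_of_eigenvector hex hv.apply_eq_smul hmax N E hN hE
  have htop : U = ⊤ := by
    refine (eq_bot_or_eq_top_of_originAction_mem hex hsimple U fun B hB w hw => ?_).resolve_left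
      fun h => hv.2 (by rwa [h] at hvU)
    refine hU.2 fun E hE => ?_
    have h := hE.1.originAction_lie hex hB w
    rw [hU.1 hw _ (hE.lie hB), hU.1 hw _ hE, map_zero, sub_zero] at h
    exact h.symm
  exact LinearMap.ext fun w => hU.1 (htop ▸ Submodule.mem_top) D hD

end Origin

/-! ### The gl_n-structure on the fibre and reconstruction of M -/

section Fibre

variable {n : ℕ} {a : Fin n → ℂ} {M : Type*} [AddCommGroup M] [Module ℂ M] [Module (A n) M]
  [LieRingModule (W n) M] [IsAWModule n M] (hex : ∀ v, ∃ N, v ∈ filt (shiftedDel a M) N)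

/-- The `gl_n`-module structure on the fibre at the origin, through linear vector fields. -/
abbrev fibreLieRingModule : LieRingModule (Gl n) (invariants (shiftedDel a M)) where
  bracket B v := originAction hex (linField B) v
  add_lie B C v := by simp only [map_add, LinearMap.add_apply]
  lie_add B v w := map_add _ v w
  leibniz_lie B C v := by
    change originAction hex (linField B) (originAction hex (linField C) v) =
      originAction hex (linField ⁅B, C⁆) v +
        originAction hex (linField C) (originAction hex (linField B) v)
    rw [linField_lie, (vanishes_linField B).originAction_lie hex (vanishes_linField C)]
    abel

theorem fibreLieModule :
    letI := fibreLieRingModule hex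
    LieModule ℂ (Gl n) (invariants (shiftedDel a M)) :=
  letI := fibreLieRingModule hex
  { smul_lie := fun c B v => by
      change originAction hex (linField (c • B)) v = c • originAction hex (linField B) v
      rw [map_smul, map_smul, LinearMap.smul_apply]
    lie_smul := fun c B v => map_smul (originAction hex (linField B)) c v }

theorem Vanishes.originAction_eq_linearPart (hsimple : IsSimpleAWModule n M)
    [FiniteDimensional ℂ (invariants (shiftedDel a M))] {D : W n} (hD : Vanishes D) :
    originAction hex D = originAction hex (linField (linearPart D)) := by
  rw [← sub_eq_zero, ← map_sub]
  exact hD.vanishesTwice_sub.originAction_eq_zero hex hsimple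

theorem isIrreducible_fibre (hsimple : IsSimpleAWModule n M)
    [FiniteDimensional ℂ (invariants (shiftedDel a M))] :
    letI := fibreLieRingModule hex
    LieModule.IsIrreducible ℂ (Gl n) (invariants (shiftedDel a M)) := by
  let := fibreLieRingModule hex
  have := fibreLieModule hex
  have := hsimple.1
  have := nontrivial_invariants hex
  refine LieModule.IsIrreducible.mk fun N hN => ?_
  have h := eq_bot_or_eq_top_of_originAction_mem hex hsimple N.toSubmodule fun D hD v hv => by
    rw [hD.originAction_eq_linearPart hex hsimple]
    exact N.lie_mem hv
  exact (LieSubmodule.toSubmodule_eq_top N).1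
    (h.resolve_left fun h => hN ((LieSubmodule.toSubmodule_eq_bot N).1 h))

theorem originAction_eq_sum (hsimple : IsSimpleAWModule n M)
    [FiniteDimensional ℂ (invariants (shiftedDel a M))] (D : W n) :
    originAction hex D =
      (∑ k, a k * MvPolynomial.constantCoeff (D (MvPolynomial.X k))) • 1 +
        originAction hex (linField (linearPart D)) := by
  have hc : linearPart (D - ∑ k, MvPolynomial.constantCoeff (D (MvPolynomial.X k)) •
      (del k : W n)) = linearPart D := by
    ext i k
    have h : ∑ k, MvPolynomial.constantCoeff (D (MvPolynomial.X k)) • (del k : W n) =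
        ∑ k, (MvPolynomial.C (MvPolynomial.constantCoeff (D (MvPolynomial.X k))) : A n) •
          (del k : W n) :=
      Finset.sum_congr rfl fun k _ => by rw [← MvPolynomial.algebraMap_eq, algebraMap_smul]
    rw [h, linearPart, linearPart, Matrix.of_apply, Matrix.of_apply, Derivation.sub_apply,
      sum_smul_del_apply_X, map_sub, MvPolynomial.pderiv_C, sub_zero]
  have hv := (vanishes_sub D).originAction_eq_linearPart hex hsimple
  rw [hc, map_sub, sub_eq_iff_eq_add'] at hv
  rw [hv, map_sum]
  congr 1
  refine LinearMap.ext fun v => ?_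
  simp only [map_smul, LinearMap.sum_apply, LinearMap.smul_apply, originAction_del, smul_smul,
    Module.End.one_apply, Finset.sum_smul, mul_comm]

theorem linField_eq_sum (B : Gl n) :
    linField B = ∑ i, ∑ k, B i k • linField (Matrix.single i k 1) := by
  simp only [← map_smul, ← map_sum]
  congr 1
  conv_lhs => rw [Matrix.matrix_eq_sum_single B]
  simp

/-- The action of a vector field on constants, by Taylor expansion. -/
theorem lie_coe_eq (hsimple : IsSimpleAWModule n M)
    [FiniteDimensional ℂ (invariants (shiftedDel a M))] (D : W n)
    (v : invariants (shiftedDel a M)) :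
    ⁅D, (v : M)⁆ = (∑ k, a k • D (MvPolynomial.X k)) • (v : M) +
      ∑ i, ∑ k, del i (D (MvPolynomial.X k)) •
        (originAction hex (linField (Matrix.single i k 1)) v : M) := by
  have hd := isWeylAction_shiftedDel a (M := M)
  have key (N : ℕ) : ∀ D ∈ filt (adDel (n := n)) N, ⁅D, (v : M)⁆ =
      (∑ k, a k • D (MvPolynomial.X k)) • (v : M) +
      ∑ i, ∑ k, del i (D (MvPolynomial.X k)) •
        (originAction hex (linField (Matrix.single i k 1)) v : M) := by
    induction N with
    | zero =>
      intro D hD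
      rw [mem_filt_zero.1 hD]
      simp
    | succ N ih =>
      intro D hD
      rw [← sub_eq_zero]
      -- The difference of the two sides is constant, because applying d_j turns each side into its
      -- analogue for [∂_j, D], of lower degree. It vanishes at the origin by `originAction_eq_sum`.
      refine hd.eq_zero_of_mem_augmentation hex (fun j => ?_) ?_
      · have h := ih _ (mem_filt_succ.1 hD j)
        rw [adDel_apply] at h
        rw [map_sub, shiftedDel_lie_of_mem_invariants v.2, h, sub_eq_zero]
        simp only [lie_del_apply_X, map_add, map_sum, hd.leibniz, mem_invariants.1 v.2 j,
          mem_invariants.1 (Subtype.prop _) j, smul_zero, add_zero, Derivation.map_smul,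
          del_comm j]
      · rw [← evalOrigin_eq_zero_iff hex, map_sub, ← originAction_apply,
          originAction_eq_sum hex hsimple, linField_eq_sum, sub_eq_zero]
        simp only [map_add, map_sum, evalOrigin_smul, evalOrigin_coe, LinearMap.add_apply,
          LinearMap.smul_apply, LinearMap.sum_apply, map_smul, Module.End.one_apply,
          MvPolynomial.smul_eq_C_mul, map_mul, MvPolynomial.constantCoeff_C]
        rfl
  obtain ⟨N, hN⟩ := exists_mem_filt_adDel D
  exact key N D hN

/-- A simple module is induced from its fibre at the origin. -/
theorem nonempty_awEquiv (hsimple : IsSimpleAWModule n M)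
    [FiniteDimensional ℂ (invariants (shiftedDel a M))] :
    letI := fibreLieRingModule hex
    haveI := fibreLieModule hex
    Nonempty (AWEquiv n M (T a (invariants (shiftedDel a M)))) := by
  let := fibreLieRingModule hex
  have := fibreLieModule hex
  have hd := isWeylAction_shiftedDel a (M := M)
  let e : A n ⊗[ℂ] invariants (shiftedDel a M) ≃ₗ[A n] M :=
    LinearEquiv.ofBijective (ofInvariants (shiftedDel a M))
      ⟨ofInvariants_injective hd, ofInvariants_surjective hd hex⟩
  have he : ∀ (D : W n) (x : A n ⊗[ℂ] invariants (shiftedDel a M)),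
      e (tAct a _ D x) = ⁅D, e x⁆ := by
    intro D x
    induction x using TensorProduct.induction_on with
    | zero => simp
    | add x y hx hy => simp only [map_add, hx, hy, lie_add]
    | tmul p v =>
      have het (p : A n) (v : invariants (shiftedDel a M)) : e (p ⊗ₜ[ℂ] v) = p • (v : M) := rfl
      have hb (B : Gl n) : ((⁅B, v⁆ : invariants (shiftedDel a M)) : M) =
        (originAction hex (linField B) v : M) := rfl
      rw [tAct_tmul, twist_apply]
      simp only [map_add, map_sum, het, hb]
      rw [IsAWModule.lie_smul_eq, lie_coe_eq hex hsimple, add_smul, smul_add, add_assoc,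
        smul_smul, mul_comm p, Finset.smul_sum]
      simp only [Finset.smul_sum, smul_smul, mul_comm p]
  exact ⟨{ (e.symm : M ≃ₗ[A n] T a (invariants (shiftedDel a M))) with
    map_lie' := fun D v => by
      change e.symm ⁅D, v⁆ = tAct a _ D (e.symm v)
      rw [LinearEquiv.symm_apply_eq, he, LinearEquiv.apply_symm_apply] }⟩

end Fibre
end WittWhittaker
end

theorem corollary3p6 (n : ℕ) (hn : 0 < n) (a : Fin n → ℂ)
    (M : Type u) [AddCommGroup M] [Module ℂ M] [Module (A n) M]
    [LieRingModule (W n) M] [IsAWModule n M]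
    (hsimple : IsSimpleAWModule n M) (hwhit : IsWhittakerOfType a M)
    (hfin : FiniteDimensional ℂ (Wh a M)) :
    ∃ (V : Type u) (_ : AddCommGroup V) (_ : Module ℂ V)
      (_ : LieRingModule (Gl n) V) (_ : LieModule ℂ (Gl n) V),
      FiniteDimensional ℂ V ∧ LieModule.IsIrreducible ℂ (Gl n) V ∧
        Nonempty (AWEquiv n M (T a V)) := by
  have hex := exists_mem_filt_shiftedDel hwhit
  have : FiniteDimensional ℂ (invariants (shiftedDel a M)) :=
    Submodule.finiteDimensional_of_le invariants_le_Wh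
  exact ⟨invariants (shiftedDel a M), inferInstance, inferInstance, fibreLieRingModule hex,
    fibreLieModule hex, this, isIrreducible_fibre hex hsimple, nonempty_awEquiv hex hsimple⟩
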